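/- **Setting.** Let $G$ and $\Theta$ be finite groups, let $\Theta$ act on $G$ by automorphisms, and let $G\rtimes\Theta$ be the semidirect product, with $(g_1,\theta_1)(g_2,\theta_2)=(g_1\theta_1(g_2),\theta_1\theta_2)$. Let $\mathrm{Col}=\{0_+,0_-,1,2,\dots\}$, with $0_\pm+1=1$; in arithmetic expressions $0_\pm$ means $0$. A disc of colour $k\ge1$ has $2k$ marked points, numbered $0,\dots,2k-1$ clockwise from the white $*$-interval, and is drawn as a box with the points $0,\dots,k-1$ on top and the others at the bottom; its black intervals are those between the points $2j$ and $2j+1$, $0\le j<k$. The boundary of a disc of colour $0_+$ is white, that of a disc of colour $0_-$ is black. **Group planar algebra.** For a finite group $H$, $P(H)$ denotes the planar algebra of the group subfactor $R^H\subset R$, in its spin model: $P(H)_k$ is the space of complex functions $f(a_0,\dots,a_{k-1})$ of spins $a_j\in H$ on the black intervals (one spin if $k=0_-$, none if $k=0_+$) with $f(ha_0,\dots,ha_{k-1})=f(a_0,\dots,a_{k-1})$ for all $h\in H$. A shaded planar tangle $T=T^{k_0}_{k_1,\dots,k_b}$ acts by $$Z_T(f_1\otimes\cdots\otimes f_b)(a)=\sqrt{|H|}^{\,w(T)}\sum_{\sigma}\prod_{i=1}^b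 f_i(\sigma|_{D_i}),$$ where $\sigma$ runs over the assignments of spins to the black regions that induce $a$ on the external disc, and $w(T)$ is the total number of counterclockwise turns of the strings, followed with black on their right, when all discs are drawn as boxes with vertical strings at their marked points (so that a closed string has the value $\sqrt{|H|}$). The 2-box labelled $g\in H$ is the function that is $1$ if $a_0^{-1}a_1=g$ and $0$ otherwise. For $\bar g=(g_1,\dots,g_{k-1})\in H^{k-1}$ let $S(\bar g)\in P(H)_k$ be the string if $k=1$, the 2-box labelled $g_1$ if $k=2$, and, if $k\ge3$, the value of the tangle with $k-1$ internal 2-boxes labelled $g_1,\dots,g_{k-1}$ in which the second black interval of the $j$-th box faces the $j$-th black interval of the external disc, and the first black intervals of all boxes lie, in this order, along the black region at the last black interval of the external disc. Thus, for $k\ge 3$, $S(\bar g)(a)=\sqrt{|H|}^{\lceil k/2\rceil-1}$ if $a_{k-1}^{-1}a_{j-1}=g_j$ for $1\le j\le k-1$, and $S(\bar g)(a)=0$ otherwise. **The two sides.** $P^\Theta_k$ is the space of the $\Theta$-invariant elements of $P(G)_k$; tangles act on it by the restriction of $Z_T$. Put $\Theta S(\bar g)=\sum_{\theta\in\Theta}S(\theta(\bar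 g))\in P^\Theta_k$ for $\bar g\in G^{k-1}$. In $P(G\rtimes\Theta)$ let $q=|\Theta|^{-1}\sum_{\theta}(e,\theta)\in P(G\rtimes\Theta)_2$ be the biprojection of $R^{G\rtimes\Theta}\subset R^\Theta\subset R$. For $x\in P(G\rtimes\Theta)_k$ let $F_k(x)$ be $x$ surrounded by $k$ 2-boxes labelled $q$, one at each black interval ($F_{0_\pm}=\mathrm{id}$), and let $P'_k=F_k(P(G\rtimes\Theta)_k)$. For a tangle $T=T^{k_0}_{k_1,\dots,k_b}$ put $$Z'_T=\alpha(T)\,F_{k_0}\circ Z_T\ \text{ on inputs from }P',\qquad \alpha(T)=|\Theta|^{c(T)/2},\qquad c(T)=\lceil k_0/2\rceil+\sum_{i=1}^b\lfloor k_i/2\rfloor-l(T),$$ where $l(T)$ is the number of closed loops after joining the two end points of every black interval of every disc of $T$. For $k\ge 1$ and $\bar g\in G^{k-1}$ put $U(\bar g)=\sum_{\theta\in\Theta,\ \bar\gamma\in\Theta^{k-1}}S((\theta(g_1),\gamma_1),\dots,(\theta(g_{k-1}),\gamma_{k-1}))$. **Theorem.** There is exactly one family of linear maps $\Phi_k:P^\Theta_k\to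 P'_k$ ($k\in\mathrm{Col}$) such that $$\Phi_k(\Theta S(\bar g))=|\Theta|^{-\lfloor k/2\rfloor}\bigl(\sqrt{|\Theta|}\bigr)^{1-\lceil k/2\rceil}\,U(\bar g)\qquad(k\ge1,\ \bar g\in G^{k-1})$$ and $\Phi_{0_\pm}(1)=1$ (both spaces being the scalars). The set of the tangles $T=T^{k_0}_{k_1,\dots,k_b}$ with $$\Phi_{k_0}(Z_T(x_1\otimes\cdots\otimes x_b))=Z'_T(\Phi_{k_1}(x_1)\otimes\cdots\otimes\Phi_{k_b}(x_b))\qquad\text{for all }x_i\in P^\Theta_{k_i}$$ contains $$\{1^{0_+},1^{0_-}\}\cup\{\mathcal E^k:k\ge2\}\cup\{(E')^k_k:k\ge1\}\cup\{E^k_{k+1},M_k,I^{k+1}_k:k\in\mathrm{Col}\}.$$ Here $1^{0_\pm}$ are the unit tangles, without discs and strings inside; the Jones projection tangle $\mathcal E^k$ has no internal disc, $k-2$ vertical strings, a string joining the last two top points and a string joining the last two bottom points; the left conditional expectation tangle $(E')^k_k$ closes the first string of its box to the left and adds a vertical string at the left; the right conditional expectation tangle $E^k_{k+1}$ closes the last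 string of its box (to the right, and to the left for $k=0_-$); the multiplication tangle $M_k$ stacks the first box on top of the second; the inclusion tangle $I^{k+1}_k$ adds a vertical string to the right of its box (to the left for $k=0_-$). -/

import Mathlib

namespace GroupPlanar

noncomputable section

/-- The set of colours `Col = {0₊, 0₋, 1, 2, 3, …}`; `succ n` is the colour `n + 1`. -/
inductive Col : Type
  | zeroPlus : Col
  | zeroMinus : Col
  | succ (n : ℕ) : Col

namespace Col

/-- The integer underlying a colour. A disc of colour `k` has `2 * k.size` marked points. -/
def size : Col → ℕ
  | zeroPlus => 0
  | zeroMinus => 0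
  | succ n => n + 1

/-- The number of black sides of a disc of colour `k`: there are `k` black boundary intervals if
`k ≥ 1`, none if `k = 0₊`, and for `k = 0₋` the whole boundary circle is one black side. -/
def sides : Col → ℕ
  | zeroPlus => 0
  | zeroMinus => 1
  | succ n => n + 1

/-- The colour `k + 1`, with `0₊ + 1 = 0₋ + 1 = 1`. -/
def up (k : Col) : Col := succ k.size

/-- `1` for the colour `0₋`, and `0` for the other colours. -/
def isMinus : Col → ℕ
  | zeroMinus => 1
  | _ => 0

theorem size_succ (n : ℕ) : (succ n).size = n + 1 := rfl

theorem size_up (k : Col) : k.up.size = k.size + 1 := rfl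

theorem size_le_sides (k : Col) : k.size ≤ k.sides := by
  cases k <;> simp [size, sides]

/-- The marked points of a disc are numbered `0, …, 2k - 1` clockwise from the white `*`-interval
(on a box: the top points from left to right, then the bottom points from right to left). The black
intervals are those between the points `2j` and `2j + 1`; this is the one at which `p` lies. -/
def sideOf (k : Col) (p : Fin (2 * k.size)) : Fin k.sides :=
  ⟨p.val / 2, by have := k.size_le_sides; have := p.isLt; omega⟩

end Col

/-- The combinatorial data of a shaded tangle on which its action and `l(T)` depend. (Planarity is not
among them; all the tangles below are planar.) The marked points of the external disc are
`Sum.inl p`, those of the internal disc `i` are `Sum.inr ⟨i, p⟩`. -/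
structure Tangle : Type 1 where
  /-- The internal discs. -/
  Disc : Type
  [fintypeDisc : Fintype Disc]
  [decEqDisc : DecidableEq Disc]
  /-- The colour `k₀` of the external disc. -/
  ext : Col
  /-- The colours `kᵢ` of the internal discs. -/
  int : Disc → Col
  /-- The number of closed strings. -/
  circles : ℕ
  /-- The marked point at the other end of the string that starts at a marked point. -/
  string : (Fin (2 * ext.size) ⊕ (Σ i, Fin (2 * (int i).size))) →
    (Fin (2 * ext.size) ⊕ (Σ i, Fin (2 * (int i).size)))
  string_string : ∀ p, string (string p) = p
  /-- The strings respect the checkerboard shading: two points of internal discs, or two points of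
  the external disc, that are joined have different parity, and a point of the external disc and
  one of an internal disc that are joined have the same parity. -/
  shaded : ∀ p, (Sum.elim (fun a => a.val + 1) (fun a => a.2.val) (string p)) % 2 ≠
    (Sum.elim (fun a => a.val + 1) (fun a => a.2.val) p) % 2
  /-- Black sides (of the external disc, of the internal discs, of the closed strings) that lie on
  different components of the boundary of one black region. Nothing has to be recorded here
  if all black regions are simply connected. -/
  link : (Fin ext.sides ⊕ (Σ i, Fin (int i).sides) ⊕ Fin circles) →
    (Fin ext.sides ⊕ (Σ i, Fin (int i).sides) ⊕ Fin circles) → Prop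

attribute [instance] Tangle.fintypeDisc Tangle.decEqDisc

namespace Tangle

/-- The marked points on the discs of a tangle. -/
abbrev Point (T : Tangle) : Type :=
  Fin (2 * T.ext.size) ⊕ (Σ i, Fin (2 * (T.int i).size))

/-- The pieces of the boundary of the black part: the black sides of the external disc and of the
internal discs, and the closed strings. -/
abbrev Side (T : Tangle) : Type :=
  Fin T.ext.sides ⊕ (Σ i, Fin (T.int i).sides) ⊕ Fin T.circles

/-- The black interval at whose end a marked point lies. -/
def side (T : Tangle) : T.Point → T.Side
  | Sum.inl p => Sum.inl (T.ext.sideOf p)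
  | Sum.inr ⟨i, p⟩ => Sum.inr (Sum.inl ⟨i, (T.int i).sideOf p⟩)

/-- `l(T)`: the number of closed loops after capping the black intervals of the external disc and
cupping the black intervals of the internal discs, that is, after joining the two end points of
every black interval. -/
def loops (T : Tangle) : ℕ :=
  Nat.card (Quot fun p p' : T.Point => p' = T.string p ∨ T.side p' = T.side p) + T.circles

/-- Two black sides that lie in one black region because a string runs along the region from one to
the other, or because of a link. The black regions are the classes of the equivalence relation
generated by this. -/
def sameRegion (T : Tangle) (a b : T.Side) : Prop :=
  (∃ p : T.Point, a = T.side p ∧ b = T.side (T.string p)) ∨ T.link a b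

/-- The number of black regions. -/
def regions (T : Tangle) : ℕ := Nat.card (Quot T.sameRegion)

/-- The Euler characteristic of the black part. A region whose boundary has `c` components has
Euler characteristic `2 - c`. The components of the boundaries of the black regions are the `l(T)`
loops and the boundary circles of the discs of colour `0₋`. -/
def eulerBlack (T : Tangle) : ℤ :=
  2 * (T.regions : ℤ) - ((T.loops : ℤ) + T.ext.isMinus + ∑ i, ((T.int i).isMinus : ℤ))

/-- `⌈k₀/2⌉ + ⌊k₁/2⌋ + ⋯ + ⌊k_b/2⌋`. -/
def halfColours (T : Tangle) : ℤ :=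
  (((T.ext.size + 1) / 2 : ℕ) : ℤ) + ∑ i, (((T.int i).size / 2 : ℕ) : ℤ)

/-- `c(T) = ⌈k₀/2⌉ + ⌊k₁/2⌋ + ⋯ + ⌊k_b/2⌋ - l(T)`. -/
def c (T : Tangle) : ℤ := T.halfColours - T.loops

/-- The sum, over the strings, of the number of full counterclockwise turns of the string when it
is followed with the black region on its right and all discs are drawn as boxes with vertical strings at their
marked points. (By Gauss-Bonnet for the black regions.) -/
def turning (T : Tangle) : ℤ :=
  T.halfColours + T.ext.isMinus - (∑ i, ((T.int i).isMinus : ℤ)) - T.eulerBlack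

end Tangle

/-- The space of functions of a spin, in the group `H`, on each black side of a disc of colour
`k`. -/
abbrev Box (H : Type*) (k : Col) : Type _ := (Fin k.sides → H) → ℂ

section Action

variable {H : Type*} [Fintype H]

open Classical in
/-- The spins on all black sides that are constant on black regions and extend the given
spins of the external disc. -/
def states (T : Tangle) (a : Fin T.ext.sides → H) : Finset (T.Side → H) :=
  Finset.univ.filter fun s =>
    (∀ x y, T.sameRegion x y → s x = s y) ∧ ∀ j, s (Sum.inl j) = a j

/-- The multilinear operator `Z_T`: the state sum over the spins of the black regions, normalised
so that the value of a closed string is `√|H|`, whichever its shading. -/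
def Z (T : Tangle) : MultilinearMap ℂ (fun i => Box H (T.int i)) (Box H T.ext) :=
  MultilinearMap.pi fun a =>
    (((Real.sqrt (Fintype.card H) : ℝ) : ℂ) ^ T.turning) •
      ∑ s ∈ states T a,
        (MultilinearMap.mkPiAlgebra ℂ T.Disc ℂ).compLinearMap fun i =>
          LinearMap.proj fun j => s (Sum.inr (Sum.inl ⟨i, j⟩))

theorem Z_apply (T : Tangle) (f : ∀ i, Box H (T.int i)) (a : Fin T.ext.sides → H) :
    Z T f a = (((Real.sqrt (Fintype.card H) : ℝ) : ℂ) ^ T.turning) *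
      ∑ s ∈ states T a, ∏ i, f i (fun j => s (Sum.inr (Sum.inl ⟨i, j⟩))) := by
  simp [Z, MultilinearMap.pi_apply]

/-- `Z_T` commutes with permutations of the spins. -/
theorem Z_comp (T : Tangle) (e : Equiv.Perm H) (f : ∀ i, Box H (T.int i))
    (a : Fin T.ext.sides → H) :
    Z T f (fun j => e (a j)) = Z T (fun i b => f i (fun j => e (b j))) a := by
  rw [Z_apply, Z_apply]
  congr 1
  symm
  refine Finset.sum_bij (fun s _ => fun x => e (s x)) ?_ ?_ ?_ ?_
  · intro s hs
    simp only [states, Finset.mem_filter, Finset.mem_univ, true_and] at hs ⊢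
    exact ⟨fun x y h => by rw [hs.1 x y h], fun j => by rw [hs.2 j]⟩
  · intro s _ s' _ h
    funext x
    exact e.injective (congrFun h x)
  · intro s hs
    simp only [states, Finset.mem_filter, Finset.mem_univ, true_and] at hs
    refine ⟨fun x => e.symm (s x), ?_, ?_⟩
    · simp only [states, Finset.mem_filter, Finset.mem_univ, true_and]
      exact ⟨fun x y h => by rw [hs.1 x y h], fun j => by rw [hs.2 j]; simp⟩
    · funext x; simp
  · intro s _; rfl

theorem Z_comp' (T : Tangle) (e : Equiv.Perm H) (f f' : ∀ i, Box H (T.int i))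
    (h : ∀ i b, f i (fun j => e (b j)) = f' i b) (a : Fin T.ext.sides → H) :
    Z T f (fun j => e (a j)) = Z T f' a := by
  rw [Z_comp]
  exact congrFun (congrArg (Z T) (funext fun i => funext fun b => h i b)) a

end Action

section Tangles

open Col

/-- The unit tangle `1^{0₊}`: no internal discs, no strings. -/
def unitPlus : Tangle where
  Disc := Empty
  ext := zeroPlus
  int := fun i => i.elim
  circles := 0
  string := id
  string_string := fun _ => rfl
  shaded := by rintro (p | ⟨i, _⟩); exacts [p.elim0, i.elim]
  link := fun _ _ => False

/-- The unit tangle `1^{0₋}`: no internal discs, no strings. -/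
def unitMinus : Tangle where
  Disc := Empty
  ext := zeroMinus
  int := fun i => i.elim
  circles := 0
  string := id
  string_string := fun _ => rfl
  shaded := by rintro (p | ⟨i, _⟩); exacts [p.elim0, i.elim]
  link := fun _ _ => False

/-- The Jones projection tangle of colour `k = n + 2`: no internal discs, `k - 2` vertical
strings, a string that joins the last two top points, and one that joins the last two bottom
points. -/
def jones (n : ℕ) : Tangle where
  Disc := Empty
  ext := succ (n + 1)
  int := fun i => i.elim
  circles := 0
  string := fun
    | Sum.inl p =>
      if p.val = n then Sum.inl ⟨n + 1, by simp only [size_succ]; omega⟩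
      else if p.val = n + 1 then Sum.inl ⟨n, by simp only [size_succ]; omega⟩
      else if p.val = n + 2 then Sum.inl ⟨n + 3, by simp only [size_succ]; omega⟩
      else if p.val = n + 3 then Sum.inl ⟨n + 2, by simp only [size_succ]; omega⟩
      else Sum.inl p.rev
    | Sum.inr ⟨i, _⟩ => i.elim
  string_string := by
    rintro (p | ⟨i, _⟩)
    · have hp := p.isLt
      simp only [size_succ] at hp
      grind [Fin.ext_iff, size_succ]
    · exact i.elim
  shaded := by
    rintro (p | ⟨i, _⟩)
    · have hp := p.isLt
      simp only [size_succ] at hp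
      grind [size_succ]
    · exact i.elim
  link := fun _ _ => False

/-- The left conditional expectation tangle `(E')^k_k` for `k = n + 1`: the first string of the
internal box is closed to its left, a vertical string is added at the left, and all other points of
the internal box are joined to those of the external box. For `k = 1` the black region is an
annulus. -/
def leftExp (n : ℕ) : Tangle where
  Disc := Unit
  ext := succ n
  int := fun _ => succ n
  circles := 0
  string := fun
    | Sum.inl p =>
      if p.val = 0 ∨ p.val = 2 * n + 1 then Sum.inl p.rev else Sum.inr ⟨(), p⟩
    | Sum.inr ⟨_, p⟩ =>
      if p.val = 0 ∨ p.val = 2 * n + 1 then Sum.inr ⟨(), p.rev⟩ else Sum.inl p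
  string_string := by
    rintro (p | ⟨⟨⟩, p⟩) <;> have hp := p.isLt <;> grind [Fin.ext_iff, size_succ]
  shaded := by
    rintro (p | ⟨⟨⟩, p⟩) <;> have hp := p.isLt <;> grind [size_succ]
  link := fun _ _ => n = 0

/-- The right conditional expectation tangle `E^k_{k+1}`: the last string of the internal box is
closed, to its right if `k ≠ 0₋` and to its left if `k = 0₋`; the other points are joined to
those of the external box. For `k = 0₋` the black region is an annulus. -/
def rightExp (k : Col) : Tangle where
  Disc := Unit
  ext := k
  int := fun _ => k.up
  circles := 0
  string := fun
    | Sum.inl p =>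
      if p.val < k.size then Sum.inr ⟨(), ⟨p.val, by have := p.isLt; simp only [size_up]; omega⟩⟩
      else Sum.inr ⟨(), ⟨p.val + 2, by have := p.isLt; simp only [size_up]; omega⟩⟩
    | Sum.inr ⟨_, p⟩ =>
      if h : p.val < k.size then Sum.inl ⟨p.val, by omega⟩
      else if h1 : p.val = k.size then
        Sum.inr ⟨(), ⟨k.size + 1, by simp only [size_up]; omega⟩⟩
      else if h2 : p.val = k.size + 1 then
        Sum.inr ⟨(), ⟨k.size, by simp only [size_up]; omega⟩⟩
      else Sum.inl ⟨p.val - 2, by have := p.isLt; simp only [size_up] at this; omega⟩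
  string_string := by
    rintro (p | ⟨⟨⟩, p⟩) <;> have hp := p.isLt <;> grind [Fin.ext_iff, size_up]
  shaded := by
    rintro (p | ⟨⟨⟩, p⟩) <;> have hp := p.isLt <;> grind [size_up]
  link := fun _ _ => k = zeroMinus

/-- The multiplication tangle `M_k`: the first box (`false`) is stacked on top of the second one
(`true`). For `k = 0₋` there is one black region, which touches all three discs. -/
def mult (k : Col) : Tangle where
  Disc := Bool
  ext := k
  int := fun _ => k
  circles := 0
  string := fun
    | Sum.inl p => if p.val < k.size then Sum.inr ⟨false, p⟩ else Sum.inr ⟨true, p⟩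
    | Sum.inr ⟨false, p⟩ => if p.val < k.size then Sum.inl p else Sum.inr ⟨true, p.rev⟩
    | Sum.inr ⟨true, p⟩ => if p.val < k.size then Sum.inr ⟨false, p.rev⟩ else Sum.inl p
  string_string := by
    rintro (p | ⟨_ | _, p⟩) <;> have hp := p.isLt <;> grind [Fin.ext_iff, size_up]
  shaded := by
    rintro (p | ⟨_ | _, p⟩) <;> have hp := p.isLt <;> grind [size_up]
  link := fun _ _ => k = zeroMinus

/-- The inclusion tangle `I_k^{k+1}`: a vertical string is added to the right of the internal box,
and to the left of it if `k = 0₋`. For `k = 0₋` the black region is an annulus. -/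
def incl (k : Col) : Tangle where
  Disc := Unit
  ext := k.up
  int := fun _ => k
  circles := 0
  string := fun
    | Sum.inr ⟨_, p⟩ =>
      if p.val < k.size then Sum.inl ⟨p.val, by have := p.isLt; simp only [size_up]; omega⟩
      else Sum.inl ⟨p.val + 2, by have := p.isLt; simp only [size_up]; omega⟩
    | Sum.inl p =>
      if h : p.val < k.size then Sum.inr ⟨(), ⟨p.val, by omega⟩⟩
      else if h1 : p.val = k.size then Sum.inl ⟨k.size + 1, by simp only [size_up]; omega⟩
      else if h2 : p.val = k.size + 1 then Sum.inl ⟨k.size, by simp only [size_up]; omega⟩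
      else Sum.inr ⟨(), ⟨p.val - 2, by have := p.isLt; simp only [size_up] at this; omega⟩⟩
  string_string := by
    rintro (p | ⟨⟨⟩, p⟩) <;> have hp := p.isLt <;> grind [Fin.ext_iff, size_up]
  shaded := by
    rintro (p | ⟨⟨⟩, p⟩) <;> have hp := p.isLt <;> grind [size_up]
  link := fun _ _ => k = zeroMinus

/-- The class of generating tangles
`{1^{0₊}, 1^{0₋}} ∪ {𝓔^k : k ≥ 2} ∪ {(E')^k_k : k ≥ 1} ∪ {E^k_{k+1}, M_k, I_k^{k+1} : k ∈ Col}`. -/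
def generatingTangles : Set Tangle :=
  {unitPlus, unitMinus} ∪ Set.range jones ∪ Set.range leftExp ∪
    (Set.range rightExp ∪ Set.range mult ∪ Set.range incl)

/-- The tangle that surrounds a box of colour `k` (the disc `none`) with 2-boxes, one at each black
interval (the disc `some j` at the interval `j`): one black side of the disc `some j` faces the
interval `j` of the external disc, the other one faces the interval `j` of the disc `none`. For
`k = 0₊` and `k = 0₋` it is the identity tangle. -/
def surround (k : Col) : Tangle where
  Disc := Option (Fin k.size)
  ext := k
  int := fun i => i.elim k fun _ => succ 1
  circles := 0
  string := fun
    | Sum.inl p => Sum.inr ⟨some ⟨p.val / 2, by have := p.isLt; omega⟩,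
        ⟨p.val % 2, by simp only [Option.elim, size_succ]; omega⟩⟩
    | Sum.inr ⟨none, p⟩ => Sum.inr ⟨some ⟨p.val / 2, by
        have := p.isLt; simp only [Option.elim] at this; omega⟩,
        ⟨3 - p.val % 2, by simp only [Option.elim, size_succ]; omega⟩⟩
    | Sum.inr ⟨some j, p⟩ =>
      if p.val < 2 then Sum.inl ⟨2 * j.val + p.val % 2, by have := j.isLt; omega⟩
      else Sum.inr ⟨none, ⟨2 * j.val + (3 - p.val) % 2, by
        have := j.isLt; simp only [Option.elim]; omega⟩⟩
  string_string := by
    rintro (p | ⟨_ | j, p⟩) <;> have hp := p.isLt <;>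
      grind [Fin.ext_iff, size_succ]
  shaded := by
    rintro (p | ⟨_ | j, p⟩) <;> have hp := p.isLt <;>
      grind [size_succ]
  link := fun _ _ => k = zeroMinus

/-- The tangle underlying the basis vectors of colour `m + 1`. Its internal discs are `m` 2-boxes. The
second black side of the box `j` faces the `j`-th black interval of the external disc, and the
first black sides of all boxes lie, in this order, along one black region, together with the
last black interval of the external disc. -/
def star (m : ℕ) : Tangle where
  Disc := Fin m
  ext := succ m
  int := fun _ => succ 1
  circles := 0
  string := fun
    | Sum.inl p =>
      if h : p.val < 2 * m then
        Sum.inr ⟨⟨p.val / 2, by omega⟩, ⟨2 + p.val % 2, by simp only [size_succ]; omega⟩⟩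
      else if hm : m = 0 then Sum.inl p.rev
      else if p.val = 2 * m then
        Sum.inr ⟨⟨m - 1, by omega⟩, ⟨0, by simp only [size_succ]; omega⟩⟩
      else Sum.inr ⟨⟨0, by omega⟩, ⟨1, by simp only [size_succ]; omega⟩⟩
    | Sum.inr ⟨j, p⟩ =>
      if p.val = 0 then
        if h : j.val + 1 < m then
          Sum.inr ⟨⟨j.val + 1, h⟩, ⟨1, by simp only [size_succ]; omega⟩⟩
        else Sum.inl ⟨2 * m, by simp only [size_succ]; omega⟩
      else if p.val = 1 then
        if j.val = 0 then Sum.inl ⟨2 * m + 1, by simp only [size_succ]; omega⟩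
        else Sum.inr ⟨⟨j.val - 1, by omega⟩, ⟨0, by simp only [size_succ]; omega⟩⟩
      else Sum.inl ⟨2 * j.val + p.val % 2, by have := j.isLt; simp only [size_succ]; omega⟩
  string_string := by
    rintro (p | ⟨j, p⟩) <;> have hp := p.isLt <;> grind [Fin.ext_iff, size_succ]
  shaded := by
    rintro (p | ⟨j, p⟩) <;> have hp := p.isLt <;> grind [size_succ]
  link := fun _ _ => False

end Tangles

section GroupAlgebra

variable {H : Type*} [Group H]

/-- The planar algebra `P(H)` of the group subfactor `R^H ⊂ R`: the `k`-box space consists of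
the functions of the spins on the black sides that are invariant under left translation of all spins
by an element of `H`. -/
def P (H : Type*) [Group H] (k : Col) : Submodule ℂ (Box H k) where
  carrier := {f | ∀ (h : H) (a : Fin k.sides → H), f (fun j => h * a j) = f a}
  add_mem' := fun {f g} hf hg h a => by simp [hf h a, hg h a]
  zero_mem' := fun _ _ => rfl
  smul_mem' := fun c f hf h a => by simp [hf h a]

open Classical in
/-- The 2-box labelled `g`. -/
def gen (g : H) : Box H (Col.succ 1) :=
  fun a => if (a ⟨0, Nat.zero_lt_two⟩)⁻¹ * a ⟨1, Nat.one_lt_two⟩ = g then 1 else 0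

theorem gen_mem (g : H) : gen g ∈ P H (Col.succ 1) := by
  intro h a
  classical exact if_congr (by simp [mul_assoc]) rfl rfl

theorem gen_aut (θ : MulAut H) (g : H) (a : Fin (Col.succ 1).sides → H) :
    gen (θ g) (fun j => θ (a j)) = gen g a := by
  classical exact if_congr (by rw [← map_inv, ← map_mul, EmbeddingLike.apply_eq_iff_eq]) rfl rfl

variable [Fintype H]

theorem Z_mem (T : Tangle) (f : ∀ i, Box H (T.int i)) (hf : ∀ i, f i ∈ P H (T.int i)) :
    Z T f ∈ P H T.ext :=
  fun h a => Z_comp' T (Equiv.mulLeft h) f f (fun i b => hf i h b) a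

/-- The labelled tangles `S(g₁, …, g_m)` of colour `k = m + 1`. For `k = 2` this is the 2-box
labelled `g₁`, and for `k = 1` it is a string. -/
def S : (m : ℕ) → (Fin m → H) → Box H (Col.succ m)
  | 0, g => Z (star 0) (fun i => gen (g i))
  | 1, g => gen (g 0)
  | m + 2, g => Z (star (m + 2)) (fun i => gen (g i))

theorem S_mem : ∀ (m : ℕ) (g : Fin m → H), S m g ∈ P H (Col.succ m)
  | 0, g => Z_mem (star 0) (fun i => gen (g i)) (fun _ => gen_mem _)
  | 1, _ => gen_mem _
  | m + 2, g => Z_mem (star (m + 2)) (fun i => gen (g i)) (fun _ => gen_mem _)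

/-- Replacing all labels by their images under an automorphism amounts to applying the automorphism
to the spins. -/
theorem S_aut (θ : MulAut H) : ∀ (m : ℕ) (g : Fin m → H) (a : Fin (Col.succ m).sides → H),
    S m (fun i => θ (g i)) (fun j => θ (a j)) = S m g a
  | 0, g, a => Z_comp' (star 0) θ.toEquiv _ _ (fun i b => gen_aut θ (g i) b) a
  | 1, g, a => gen_aut θ (g 0) a
  | m + 2, g, a => Z_comp' (star (m + 2)) θ.toEquiv _ _ (fun i b => gen_aut θ (g i) b) a

end GroupAlgebra

section Theta

variable {G Θ : Type*} [Group G] [Group Θ] (φ : Θ →* MulAut G)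

/-- `P^Θ`: the elements of `P(G)` that are invariant under the action of `Θ`. -/
def PTheta (k : Col) : Submodule ℂ (Box G k) where
  carrier := {f | f ∈ P G k ∧ ∀ (θ : Θ) (a : Fin k.sides → G), f (fun j => φ θ (a j)) = f a}
  add_mem' := fun {f g} hf hg =>
    ⟨add_mem hf.1 hg.1, fun θ a => by simp [hf.2 θ a, hg.2 θ a]⟩
  zero_mem' := ⟨zero_mem _, fun _ _ => rfl⟩
  smul_mem' := fun c f hf => ⟨Submodule.smul_mem _ c hf.1, fun θ a => by simp [hf.2 θ a]⟩

/-- The constant function `1`. -/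
def one (k : Col) : PTheta φ k := ⟨fun _ => 1, fun _ _ => rfl, fun _ _ => rfl⟩

instance [Fintype G] [Fintype Θ] : Fintype (G ⋊[φ] Θ) :=
  Fintype.ofEquiv (G × Θ) SemidirectProduct.equivProd.symm

variable [Fintype G] [Fintype Θ]

/-- The action of a tangle on `P^Θ`, which is the restriction of its action on `P(G)`. -/
def ZTheta (T : Tangle) (x : ∀ i, PTheta φ (T.int i)) : PTheta φ T.ext :=
  ⟨Z T (fun i => (x i : Box G (T.int i))), Z_mem T _ (fun i => (x i).2.1), fun θ a =>
    Z_comp' T (φ θ).toEquiv _ _ (fun i b => (x i).2.2 θ b) a⟩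

/-- `Θ S(g) = ∑_θ S(θ(g))`. -/
def thetaS (m : ℕ) (g : Fin m → G) : PTheta φ (Col.succ m) :=
  ⟨∑ θ : Θ, S m (fun i => φ θ (g i)), Submodule.sum_mem _ (fun _ _ => S_mem _ _), fun η a => by
    rw [Finset.sum_apply, Finset.sum_apply]
    refine (Fintype.sum_equiv (Equiv.mulLeft η) _ _ (fun θ => ?_)).symm
    rw [← S_aut (φ η) m (fun i => φ θ (g i)) a]
    simp⟩

/-- The biprojection `q = |Θ|⁻¹ ∑_θ (e, θ)` of `R^{G ⋊ Θ} ⊂ R^Θ ⊂ R`. -/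
def q : Box (G ⋊[φ] Θ) (Col.succ 1) :=
  ((Fintype.card Θ : ℂ)⁻¹) • ∑ θ : Θ, gen (⟨1, θ⟩ : G ⋊[φ] Θ)

/-- The inputs of the tangle `surround k`: `q` at all 2-boxes and `x` at the box of colour `k`. -/
def surroundInput (k : Col) (x : Box (G ⋊[φ] Θ) k) :
    ∀ i : (surround k).Disc, Box (G ⋊[φ] Θ) ((surround k).int i)
  | none => x
  | some _ => q φ

/-- `F_k(x)`: the element `x` surrounded with `q`'s. -/
def F (k : Col) : Box (G ⋊[φ] Θ) k →ₗ[ℂ] Box (G ⋊[φ] Θ) k where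
  toFun x := Z (surround k) (surroundInput φ k x)
  map_add' x y := by
    have h : ∀ z, surroundInput φ k z = Function.update (surroundInput φ k 0) none z := by
      intro z; funext i; cases i <;> rfl
    rw [h (x + y), h x, h y]
    exact (Z (surround k)).map_update_add _ none x y
  map_smul' c x := by
    have h : ∀ z, surroundInput φ k z = Function.update (surroundInput φ k 0) none z := by
      intro z; funext i; cases i <;> rfl
    rw [h (c • x), h x]
    exact (Z (surround k)).map_update_smul _ none c x

/-- `P'_k = F_k(P_k(G ⋊ Θ))`. -/
def PPrime (k : Col) : Submodule ℂ (Box (G ⋊[φ] Θ) k) := (P (G ⋊[φ] Θ) k).map (F φ k)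

theorem PPrime_le (k : Col) : PPrime φ k ≤ P (G ⋊[φ] Θ) k := by
  rintro _ ⟨x, hx, rfl⟩
  refine Z_mem (surround k) _ ?_
  rintro (_ | i)
  · exact hx
  · exact Submodule.smul_mem _ _ (Submodule.sum_mem _ (fun _ _ => gen_mem _))

/-- `α(T) = [R : R^Θ]^{c(T)/2} = |Θ|^{c(T)/2}`. -/
def alpha (Θ : Type*) [Fintype Θ] (T : Tangle) : ℂ :=
  ((Real.sqrt (Fintype.card Θ) : ℝ) : ℂ) ^ T.c

/-- `Z'_T = α(T) Z_{F(T)} = α(T) F_{k₀} ∘ Z_T`, on inputs from `P'`. -/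
def ZPrime (T : Tangle) (x : ∀ i, PPrime φ (T.int i)) : PPrime φ T.ext :=
  ⟨alpha Θ T • F φ T.ext (Z T (fun i => (x i : Box (G ⋊[φ] Θ) (T.int i)))),
    Submodule.smul_mem _ _ (Submodule.mem_map_of_mem
      (Z_mem T _ (fun i => PPrime_le φ _ (x i).2)))⟩

/-- `U(g) = ∑_{θ, γ} S((θ(g₁), γ₁), …, (θ(g_m), γ_m))`. -/
def U (m : ℕ) (g : Fin m → G) : Box (G ⋊[φ] Θ) (Col.succ m) :=
  ∑ θ : Θ, ∑ γ : Fin m → Θ, S m (fun i => (⟨φ θ (g i), γ i⟩ : G ⋊[φ] Θ))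

/-- The defining property of the linear maps `Φ_k : P^Θ_k → P'_k`. For `k = m + 1 ≥ 1`,
`Φ_k(Θ S(g)) = |Θ|^{-⌊k/2⌋} (√|Θ|)^{1 - ⌈k/2⌉} U(g)`. For `k = 0₊, 0₋` both spaces are the scalars
(the constant functions), and `Φ_k` is the identity. -/
def IsPhi (Φ : ∀ k, PTheta φ k →ₗ[ℂ] PPrime φ k) : Prop :=
  (∀ (m : ℕ) (g : Fin m → G),
    (Φ (Col.succ m) (thetaS φ m g) : Box (G ⋊[φ] Θ) (Col.succ m)) =
      ((Fintype.card Θ : ℂ) ^ (-(((m + 1) / 2 : ℕ) : ℤ)) *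
        ((Real.sqrt (Fintype.card Θ) : ℝ) : ℂ) ^ (1 - (((m + 2) / 2 : ℕ) : ℤ))) • U φ m g) ∧
  (Φ Col.zeroPlus (one φ Col.zeroPlus) : Box (G ⋊[φ] Θ) Col.zeroPlus) = (fun _ => 1) ∧
  (Φ Col.zeroMinus (one φ Col.zeroMinus) : Box (G ⋊[φ] Θ) Col.zeroMinus) = (fun _ => 1)

/-- The set of the tangles `T` with
`Φ_{k₀}(Z_T(x₁ ⊗ ⋯ ⊗ x_b)) = Z'_T(Φ_{k₁}(x₁) ⊗ ⋯ ⊗ Φ_{k_b}(x_b))` for all inputs from `P^Θ`. -/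
def intertwined (Φ : ∀ k, PTheta φ k →ₗ[ℂ] PPrime φ k) : Set Tangle :=
  {T | ∀ x : ∀ i, PTheta φ (T.int i),
    Φ T.ext (ZTheta φ T x) = ZPrime φ T (fun i => Φ (T.int i) (x i))}

end Theta

end

end GroupPlanar

/-
In the spin model a state is a choice of a spin on each black region. Surrounding an element of
`P(G ⋊ Θ)` with copies of `q` averages it over the `Θ`-components of its spins, so that, up to a
scalar, `Φ_k` is the pull-back of functions along the projection of the spins from `G ⋊ Θ` to `G`.
A state with spins in `G` has `|Θ| ^ r` lifts to `G ⋊ Θ`, where `r` is the number of black regions.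
The Euler characteristic of the black part relates `r` and `l(T)` to the turning number, and shows
that `α(T)` compensates exactly the resulting power of `√|Θ|`, for every tangle `T`.
-/

namespace GroupPlanar

noncomputable section

open Col

theorem Col.sideOf_surjective (n : ℕ) : Function.Surjective (sideOf (succ n)) := fun j =>
  ⟨⟨2 * j.val, Nat.mul_lt_mul_of_pos_left j.isLt Nat.two_pos⟩, Fin.ext <| by simp [sideOf]⟩

theorem Col.sides_eq (k : Col) : k.sides = (k.size + 1) / 2 + k.size / 2 + k.isMinus := by
  cases k <;> simp only [sides, size, isMinus]
  omega

section LoopValue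

variable (H : Type*) [Fintype H]

/-- The value `√|H|` of a closed string in the planar algebra `P(H)`. -/
def loopValue : ℂ := ((Real.sqrt (Fintype.card H) : ℝ) : ℂ)

theorem loopValue_sq : loopValue H ^ 2 = Fintype.card H := by
  rw [loopValue, ← Complex.ofReal_pow, Real.sq_sqrt (Nat.cast_nonneg _), Complex.ofReal_natCast]

theorem card_zpow_eq_loopValue_zpow (z : ℤ) :
    (Fintype.card H : ℂ) ^ z = loopValue H ^ (2 * z) := by
  rw [zpow_mul, zpow_ofNat, loopValue_sq]

theorem loopValue_ne_zero [Nonempty H] : loopValue H ≠ 0 := by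
  simp [loopValue]

end LoopValue

namespace Tangle

variable (T : Tangle)

/-- The type of black regions of a tangle. -/
abbrev Region : Type := Quot T.sameRegion

instance : Fintype T.Region := Fintype.ofFinite _

/-- The black region along which a piece of the boundary of the black part lies. -/
def region : T.Side → T.Region := Quot.mk T.sameRegion

theorem regions_eq_card : T.regions = Fintype.card T.Region := Nat.card_eq_fintype_card

variable {T} in
theorem region_eq_of_string {p p' : T.Point} {a b : T.Side} (h : T.string p = p')
    (ha : T.side p = a) (hb : T.side p' = b) : T.region a = T.region b := by
  subst h ha hb
  exact Quot.sound (Or.inl ⟨p, rfl, rfl⟩)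

variable {T} in
theorem side_inl_eq {p : Fin (2 * T.ext.size)} {b : Fin T.ext.sides} (h : p.val / 2 = b.val) :
    T.side (Sum.inl p) = Sum.inl b :=
  congrArg Sum.inl (Fin.ext h)

variable {T} in
theorem side_inr_eq {i : T.Disc} {p : Fin (2 * (T.int i).size)} {b : Fin (T.int i).sides}
    (h : p.val / 2 = b.val) : T.side (Sum.inr ⟨i, p⟩) = Sum.inr (Sum.inl ⟨i, b⟩) := by
  obtain rfl : (T.int i).sideOf p = b := Fin.ext h
  rfl

theorem turning_eq :
    T.turning = T.halfColours + 2 * T.ext.isMinus + T.loops - 2 * T.regions := by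
  unfold turning eulerBlack
  ring

theorem loops_eq_regions (hside : Function.Surjective T.side) (hcirc : T.circles = 0)
    (hlink : ∀ a b, ¬ T.link a b) : T.loops = T.regions := by
  unfold loops regions
  rw [hcirc, add_zero]
  refine Nat.card_congr
    { toFun := Quot.lift (fun p => T.region (T.side p)) ?_
      invFun := Quot.lift (fun a => Quot.mk _ (Function.surjInv hside a)) ?_
      left_inv := ?_
      right_inv := ?_ }
  · rintro p _ (rfl | h)
    · exact region_eq_of_string rfl rfl rfl
    · rw [h]
  · rintro _ _ (⟨p, rfl, rfl⟩ | h)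
    · calc Quot.mk _ (Function.surjInv hside (T.side p))
          = Quot.mk _ p := Quot.sound (Or.inr (Function.surjInv_eq hside _).symm)
        _ = Quot.mk _ (T.string p) := Quot.sound (Or.inl rfl)
        _ = _ := Quot.sound (Or.inr (Function.surjInv_eq hside _))
    · exact (hlink _ _ h).elim
  · rintro ⟨p⟩
    exact Quot.sound (Or.inr (Function.surjInv_eq hside _).symm)
  · rintro ⟨a⟩
    exact congrArg T.region (Function.surjInv_eq hside a)

end Tangle

section StateSum

variable {H : Type*} [Fintype H]

open Classical in
theorem sum_states (T : Tangle) (a : Fin T.ext.sides → H) (w : (T.Side → H) → ℂ) :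
    ∑ s ∈ states T a, w s =
      ∑ r : T.Region → H with (fun j => r (T.region (Sum.inl j))) = a, w (r ∘ T.region) := by
  simp only [states, Finset.sum_filter, ← funext_iff (g := a), ite_and]
  rw [← Finset.sum_filter]
  refine Finset.sum_bij' (fun s hs => Quot.lift s (Finset.mem_filter.1 hs).2)
    (fun r _ => r ∘ T.region) ?_ ?_ ?_ ?_ ?_
  · exact fun _ _ => Finset.mem_univ _
  · exact fun r _ => Finset.mem_filter.2
      ⟨Finset.mem_univ _, fun x y hxy => congrArg r (Quot.sound hxy)⟩
  · exact fun _ _ => rfl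
  · exact fun _ _ => funext (Quot.ind fun _ => rfl)
  · exact fun _ _ => rfl

theorem Z_apply_of_regionEquiv {T : Tangle} {β : Type*} [Fintype β] [DecidableEq β]
    (e : T.Region ≃ Fin T.ext.sides ⊕ β) (he : ∀ j, e (T.region (Sum.inl j)) = Sum.inl j)
    (f : ∀ i, Box H (T.int i)) (a : Fin T.ext.sides → H) :
    Z T f a = loopValue H ^ T.turning * ∑ b : β → H,
      ∏ i, f i fun j => Sum.elim a b (e (T.region (Sum.inr (Sum.inl ⟨i, j⟩)))) := by
  classical
  rw [Z_apply, sum_states T a fun s => ∏ i, f i fun j => s (Sum.inr (Sum.inl ⟨i, j⟩))]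
  have extend_eq (r : T.Region → H) (hr : (fun j => r (T.region (Sum.inl j))) = a) :
      Sum.elim a (fun x => r (e.symm (Sum.inr x))) ∘ e = r := by
    rw [← Equiv.eq_comp_symm]
    funext j
    rcases j with j | x
    · rw [Function.comp_apply, ← he j, e.symm_apply_apply, he]
      exact (congrFun hr j).symm
    · rfl
  refine congrArg _ (Finset.sum_bij' (fun r _ x => r (e.symm (Sum.inr x)))
    (fun b _ => Sum.elim a b ∘ e) ?_ ?_ ?_ ?_ ?_)
  · exact fun _ _ => Finset.mem_univ _
  · simp [he]
  · exact fun r hr => extend_eq r (Finset.mem_filter.1 hr).2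
  · simp
  · intro r hr
    nth_rewrite 1 [← extend_eq r (Finset.mem_filter.1 hr).2]
    rfl

end StateSum

/-- The label of the black region of a side of `star m`: the number of the external black interval
that it touches. -/
def starLabel (m : ℕ) : (star m).Side → Fin (m + 1)
  | Sum.inl j => j
  | Sum.inr (Sum.inl ⟨j, b⟩) => if b.val = 0 then Fin.last m else Fin.castSucc j
  | Sum.inr (Sum.inr i) => Fin.elim0 i

theorem starLabel_side_val (m : ℕ) (p : (star m).Point) :
    (starLabel m ((star m).side p)).val =
      Sum.elim (fun a => a.val / 2) (fun a => if a.2.val < 2 then m else a.1.val) p := by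
  rcases p with p | ⟨j, p⟩
  · rfl
  · change (if p.val / 2 = 0 then Fin.last m else Fin.castSucc j).val =
      if p.val < 2 then m else j.val
    split_ifs <;> first | rfl | omega

theorem starLabel_side_string (m : ℕ) (p : (star m).Point) :
    starLabel m ((star m).side ((star m).string p)) = starLabel m ((star m).side p) := by
  ext
  rw [starLabel_side_val, starLabel_side_val]
  rcases p with p | ⟨j, p⟩
  · have : p.val < 2 * (m + 1) := p.isLt
    simp only [star]
    split_ifs <;> grind [size_succ]
  · have : p.val < 4 := p.isLt
    have : j.val < m := j.isLt
    simp only [star]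
    split_ifs <;> grind

theorem region_star_first (m : ℕ) (j : Fin m) :
    (star m).region (Sum.inl (Fin.last m)) =
      (star m).region (Sum.inr (Sum.inl ⟨j, ⟨0, Nat.zero_lt_two⟩⟩)) := by
  obtain ⟨j, hj⟩ := j
  induction j with
  | zero =>
    symm
    refine Tangle.region_eq_of_string (T := star m)
      (p := Sum.inr ⟨⟨0, hj⟩, ⟨1, by simp [star, size]⟩⟩)
      (p' := Sum.inl ⟨2 * m + 1, by simp only [star, size]; omega⟩) ?_ ?_ ?_
    · simp [star]
    · exact Tangle.side_inr_eq (by simp)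
    · exact Tangle.side_inl_eq (by simp only [Fin.val_last]; omega)
  | succ j ih =>
    refine (ih (by omega)).trans (Eq.symm ?_)
    refine Tangle.region_eq_of_string (T := star m)
      (p := Sum.inr ⟨⟨j + 1, hj⟩, ⟨1, by simp [star, size]⟩⟩)
      (p' := Sum.inr ⟨⟨j, by omega⟩, ⟨0, by simp [star, size]⟩⟩) ?_ ?_ ?_
    · simp [star]
    · exact Tangle.side_inr_eq (by simp)
    · exact Tangle.side_inr_eq (by simp)

theorem region_star_second (m : ℕ) (j : Fin m) :
    (star m).region (Sum.inl j.castSucc) =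
      (star m).region (Sum.inr (Sum.inl ⟨j, ⟨1, Nat.one_lt_two⟩⟩)) := by
  symm
  refine Tangle.region_eq_of_string (T := star m) (p := Sum.inr ⟨j, ⟨2, by simp [star, size]⟩⟩)
    (p' := Sum.inl ⟨2 * j.val, by simp [star, size]⟩) ?_ ?_ ?_
  · simp [star]
  · exact Tangle.side_inr_eq (by simp)
  · exact Tangle.side_inl_eq (by simp)

/-- The black regions of `star m` correspond to the external black intervals. -/
def starRegionEquiv (m : ℕ) : (star m).Region ≃ Fin (m + 1) where
  toFun := Quot.lift (starLabel m) <| by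
    rintro _ _ (⟨p, rfl, rfl⟩ | h)
    · exact (starLabel_side_string m p).symm
    · exact h.elim
  invFun j := (star m).region (Sum.inl j)
  left_inv := by
    rintro ⟨j | ⟨j, b⟩ | i⟩
    · rfl
    · fin_cases b
      · exact region_star_first m j
      · exact region_star_second m j
    · exact i.elim0
  right_inv _ := rfl

theorem star_turning (m : ℕ) : (star m).turning = ((m + 2) / 2 : ℕ) - 1 := by
  have hreg : (star m).regions = m + 1 := by
    rw [Tangle.regions_eq_card, Fintype.card_congr (starRegionEquiv m), Fintype.card_fin]
  have hloop : (star m).loops = m + 1 := by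
    rw [← hreg]
    refine Tangle.loops_eq_regions _ ?_ rfl (fun _ _ h => h)
    rintro (j | ⟨i, j⟩ | i)
    · obtain ⟨p, rfl⟩ := Col.sideOf_surjective m j
      exact ⟨Sum.inl p, rfl⟩
    · obtain ⟨p, rfl⟩ := Col.sideOf_surjective 1 j
      exact ⟨Sum.inr ⟨i, p⟩, rfl⟩
    · exact i.elim0
  have hhalf : (star m).halfColours = ((m + 2) / 2 : ℕ) + m := by
    change (((m + 2) / 2 : ℕ) : ℤ) + ∑ _i : Fin m, (((succ 1).size / 2 : ℕ) : ℤ) = _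
    simp [size]
  have hminus : (star m).ext.isMinus = 0 := rfl
  rw [Tangle.turning_eq, hreg, hloop, hhalf, hminus]
  push_cast
  ring

section StarElements

variable {H : Type*} [Group H]

/-- The black interval at the reference spin of `S(ḡ)`, with respect to which the labels are the
relative spins at the other intervals. It is the last interval for the tangle `star m`, but the
first one for a 2-box. -/
def baseSide (m : ℕ) : Fin (m + 1) := if m = 1 then 0 else Fin.last m

/-- The spins relative to the one at `baseSide m`; at the spins `a`, the only `S(ḡ)` that does not
vanish is the one with these labels. -/
def relSpins (m : ℕ) (a : Fin (m + 1) → H) : Fin m → H :=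
  fun j => (a (baseSide m))⁻¹ * a ((baseSide m).succAbove j)

variable [Fintype H]

open Classical in
theorem Z_star_apply (m : ℕ) (g : Fin m → H) (a : Fin (m + 1) → H) :
    Z (star m) (fun i => gen (g i)) a = loopValue H ^ (star m).turning *
      if (fun j => (a (Fin.last m))⁻¹ * a j.castSucc) = g then 1 else 0 := by
  refine (Z_apply_of_regionEquiv ((starRegionEquiv m).trans (Equiv.sumEmpty _ Empty).symm)
    (fun _ => rfl) _ a).trans (congrArg _ ?_)
  rw [Fintype.sum_unique]
  exact (Fintype.prod_boole (M₀ := ℂ)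
    (p := fun j : Fin m => (a (Fin.last m))⁻¹ * a j.castSucc = g j)).trans
    (by simp only [funext_iff]; congr)

open Classical in
theorem S_apply : ∀ (m : ℕ) (g : Fin m → H) (a : Fin (m + 1) → H),
    S m g a = loopValue H ^ (star m).turning * if relSpins m a = g then 1 else 0
  | 0, g, a => (Z_star_apply 0 g a).trans <| by simp only [eq_iff_true_of_subsingleton]
  | 1, g, a => by
    rw [show (star 1).turning = 0 from star_turning 1, zpow_zero, one_mul]
    exact if_congr (by rw [funext_iff, Fin.forall_fin_one]; rfl) rfl rfl
  | m + 2, g, a => by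
    have hrel : relSpins (m + 2) a = fun j => (a (Fin.last (m + 2)))⁻¹ * a j.castSucc :=
      funext fun j => by simp [relSpins, baseSide]
    exact (Z_star_apply (m + 2) g a).trans (by rw [hrel])

end StarElements

/-- The label of the black region of a side of the surrounding tangle: the number of the black
interval together with the disc, external (`inl`) or `none` (`inr`), that the region touches. -/
def surroundLabel (n : ℕ) : (surround (succ n)).Side → Fin (n + 1) ⊕ Fin (n + 1)
  | Sum.inl j => Sum.inl j
  | Sum.inr (Sum.inl ⟨none, j⟩) => Sum.inr j
  | Sum.inr (Sum.inl ⟨some j, b⟩) => if b.val = 0 then Sum.inl j else Sum.inr j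
  | Sum.inr (Sum.inr i) => Fin.elim0 i

theorem surroundLabel_side_string (n : ℕ) (p : (surround (succ n)).Point) :
    surroundLabel n ((surround (succ n)).side ((surround (succ n)).string p)) =
      surroundLabel n ((surround (succ n)).side p) := by
  rcases p with p | ⟨_ | j, p⟩
  · exact if_pos (show p.val % 2 / 2 = 0 by omega)
  · exact if_neg (show (3 - p.val % 2) / 2 ≠ 0 by omega)
  · have : p.val < 4 := p.isLt
    simp only [surround]
    split_ifs with h
    · refine Eq.trans ?_ (if_pos (show p.val / 2 = 0 by omega)).symm
      exact congrArg Sum.inl (Fin.ext (show (2 * j.val + p.val % 2) / 2 = j.val by omega))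
    · refine Eq.trans ?_ (if_neg (show p.val / 2 ≠ 0 by omega)).symm
      exact congrArg Sum.inr (Fin.ext (show (2 * j.val + (3 - p.val) % 2) / 2 = j.val by omega))

theorem region_surround_first (n : ℕ) (j : Fin (n + 1)) :
    (surround (succ n)).region (Sum.inl j) =
      (surround (succ n)).region (Sum.inr (Sum.inl ⟨some j, ⟨0, Nat.zero_lt_two⟩⟩)) := by
  symm
  refine Tangle.region_eq_of_string (T := surround (succ n))
    (p := Sum.inr ⟨some j, ⟨0, Nat.succ_pos 3⟩⟩)
    (p' := Sum.inl ⟨2 * j.val, Nat.mul_lt_mul_of_pos_left j.isLt Nat.two_pos⟩) rfl ?_ ?_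
  · exact Tangle.side_inr_eq (by simp)
  · exact Tangle.side_inl_eq (by simp)

theorem region_surround_second (n : ℕ) (j : Fin (n + 1)) :
    (surround (succ n)).region (Sum.inr (Sum.inl ⟨none, j⟩)) =
      (surround (succ n)).region (Sum.inr (Sum.inl ⟨some j, ⟨1, Nat.one_lt_two⟩⟩)) := by
  symm
  refine Tangle.region_eq_of_string (T := surround (succ n))
    (p := Sum.inr ⟨some j, ⟨3, Nat.lt_succ_self 3⟩⟩)
    (p' := Sum.inr ⟨none, ⟨2 * j.val, Nat.mul_lt_mul_of_pos_left j.isLt Nat.two_pos⟩⟩) rfl ?_ ?_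
  · exact Tangle.side_inr_eq (by simp)
  · exact Tangle.side_inr_eq (by simp)

/-- The black regions of the tangle that surrounds a box of colour `n + 1`: one at each black
interval of the external disc, and one at each black interval of the surrounded box. -/
def surroundRegionEquiv (n : ℕ) :
    (surround (succ n)).Region ≃ Fin (n + 1) ⊕ Fin (n + 1) where
  toFun := Quot.lift (surroundLabel n) <| by
    rintro _ _ (⟨p, rfl, rfl⟩ | h)
    · exact (surroundLabel_side_string n p).symm
    · exact Col.noConfusion h
  invFun := Sum.elim (fun j => (surround (succ n)).region (Sum.inl j))
    fun j => (surround (succ n)).region (Sum.inr (Sum.inl ⟨none, j⟩))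
  left_inv := by
    rintro ⟨j | ⟨_ | j, b⟩ | i⟩
    · rfl
    · rfl
    · fin_cases b
      · exact region_surround_first n j
      · exact region_surround_second n j
    · exact i.elim0
  right_inv := by rintro (j | j) <;> rfl

theorem surround_succ_turning (n : ℕ) : (surround (succ n)).turning = 0 := by
  have hreg : (surround (succ n)).regions = 2 * (n + 1) := by
    rw [Tangle.regions_eq_card, Fintype.card_congr (surroundRegionEquiv n), Fintype.card_sum,
      Fintype.card_fin, two_mul]
  have hloop : (surround (succ n)).loops = 2 * (n + 1) := by
    rw [← hreg]
    refine Tangle.loops_eq_regions _ ?_ rfl (fun _ _ h => Col.noConfusion h)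
    rintro (j | ⟨_ | i, j⟩ | i)
    · obtain ⟨p, rfl⟩ := Col.sideOf_surjective n j
      exact ⟨Sum.inl p, rfl⟩
    · obtain ⟨p, rfl⟩ := Col.sideOf_surjective n j
      exact ⟨Sum.inr ⟨none, p⟩, rfl⟩
    · obtain ⟨p, rfl⟩ := Col.sideOf_surjective 1 j
      exact ⟨Sum.inr ⟨some i, p⟩, rfl⟩
    · exact i.elim0
  have hhalf : (surround (succ n)).halfColours = 2 * (n + 1) := by
    change (((n + 2) / 2 : ℕ) : ℤ) +
      ∑ i : Option (Fin (n + 1)), (((i.elim (succ n) fun _ => succ 1).size / 2 : ℕ) : ℤ) = _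
    simp only [Fintype.sum_option, Option.elim, size, Finset.sum_const, Finset.card_univ,
      Fintype.card_fin, nsmul_eq_mul]
    omega
  have hminus : (surround (succ n)).ext.isMinus = 0 := rfl
  rw [Tangle.turning_eq, hreg, hloop, hhalf, hminus]
  push_cast
  ring

theorem isEmpty_point_surround {k : Col} (hk : k.size = 0) : IsEmpty (surround k).Point := by
  refine ⟨?_⟩
  rintro (p | ⟨_ | i, p⟩)
  · exact (p.cast (congrArg (2 * ·) hk)).elim0
  · exact (p.cast (congrArg (2 * ·) hk)).elim0
  · exact (i.cast hk).elim0

/-- For the colours `0₊` and `0₋` the surrounding tangle is the identity tangle, whose black regions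
correspond to the black sides of the box. -/
def surroundZeroRegionEquiv {k : Col} (hk : k.size = 0) : (surround k).Region ≃ Fin k.sides where
  toFun := Quot.lift
    (fun
      | Sum.inl j => j
      | Sum.inr (Sum.inl ⟨none, j⟩) => j
      | Sum.inr (Sum.inl ⟨some i, _⟩) => (i.cast hk).elim0
      | Sum.inr (Sum.inr i) => i.elim0) <| by
    rintro x y (⟨p, -⟩ | h)
    · exact (isEmpty_point_surround hk).elim p
    · have : k.sides = 1 := congrArg sides (show k = zeroMinus from h)
      have : Subsingleton (Fin k.sides) := Fin.subsingleton_iff_le_one.2 this.le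
      exact Subsingleton.elim _ _
  invFun j := (surround k).region (Sum.inl j)
  left_inv := by
    rintro ⟨j | ⟨_ | i, j⟩ | i⟩
    · rfl
    · cases k with
      | zeroPlus => exact j.elim0
      | zeroMinus => exact Quot.sound (Or.inr rfl)
      | succ n => exact absurd hk n.succ_ne_zero
    · exact (i.cast hk).elim0
    · exact i.elim0
  right_inv _ := rfl

theorem surround_zero_turning {k : Col} (hk : k.size = 0) : (surround k).turning = 0 := by
  have hreg : (surround k).regions = k.isMinus := by
    rw [Tangle.regions_eq_card, Fintype.card_congr (surroundZeroRegionEquiv hk), Fintype.card_fin,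
      Col.sides_eq, hk]
    simp
  have hloop : (surround k).loops = 0 := by
    have := isEmpty_point_surround hk
    change Nat.card (Quot _) + 0 = 0
    exact Nat.card_of_isEmpty
  have hhalf : (surround k).halfColours = 0 := by
    have hdisc : IsEmpty (Fin k.size) := hk ▸ Fin.isEmpty
    change (((k.size + 1) / 2 : ℕ) : ℤ) +
      ∑ i : Option (Fin k.size), (((i.elim k fun _ => succ 1).size / 2 : ℕ) : ℤ) = 0
    rw [Fintype.sum_option]
    simp [hk]
  have hminus : (surround k).ext.isMinus = k.isMinus := rfl
  rw [Tangle.turning_eq, hreg, hloop, hhalf, hminus]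
  ring

section Semidirect

variable {G Θ : Type*} [Group G] [Group Θ] {φ : Θ →* MulAut G}

theorem left_inv_mul (x y : G ⋊[φ] Θ) :
    (x⁻¹ * y).left = φ x.right⁻¹ (x.left⁻¹ * y.left) := by
  simp

variable (φ) in
/-- The function of spins in `G ⋊ Θ` that depends only on their components in `G`. -/
def lift (k : Col) : Box G k →ₗ[ℂ] Box (G ⋊[φ] Θ) k where
  toFun f a := f fun j => (a j).left
  map_add' _ _ := rfl
  map_smul' _ _ := rfl

theorem lift_apply (k : Col) (f : Box G k) (a : Fin k.sides → G ⋊[φ] Θ) :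
    lift φ k f a = f fun j => (a j).left := rfl

theorem lift_mem_P {k : Col} {f : Box G k} (hf : f ∈ PTheta φ k) : lift φ k f ∈ P (G ⋊[φ] Θ) k :=
  fun h a => (hf.1 h.left fun j => φ h.right (a j).left).trans (hf.2 h.right fun j => (a j).left)

theorem gen_one_right_apply [DecidableEq G] [DecidableEq Θ] (θ : Θ)
    (a : Fin (succ 1).sides → G ⋊[φ] Θ) : gen (⟨1, θ⟩ : G ⋊[φ] Θ) a =
      if ((a ⟨0, Nat.zero_lt_two⟩)⁻¹ * a ⟨1, Nat.one_lt_two⟩).right = θ then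
        if (a ⟨0, Nat.zero_lt_two⟩).left = (a ⟨1, Nat.one_lt_two⟩).left then 1 else 0
      else 0 := by
  rw [← ite_and, gen]
  congr 1
  rw [SemidirectProduct.ext_iff, left_inv_mul, EmbeddingLike.map_eq_one_iff, inv_mul_eq_one,
    and_comm]

theorem q_apply [DecidableEq G] [Fintype Θ] (a : Fin (succ 1).sides → G ⋊[φ] Θ) :
    q φ a = if (a ⟨0, Nat.zero_lt_two⟩).left = (a ⟨1, Nat.one_lt_two⟩).left then
      (Fintype.card Θ : ℂ)⁻¹ else 0 := by
  classical
  rw [q, Pi.smul_apply, Finset.sum_apply, Finset.sum_congr rfl fun θ _ => gen_one_right_apply θ a,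
    Finset.sum_ite_eq, if_pos (Finset.mem_univ _), smul_eq_mul, mul_ite, mul_one, mul_zero]

variable [Fintype G] [Fintype Θ]

theorem loopValue_semidirect : loopValue (G ⋊[φ] Θ) = loopValue G * loopValue Θ := by
  rw [loopValue, Fintype.card_congr SemidirectProduct.equivProd, Fintype.card_prod, Nat.cast_mul,
    Real.sqrt_mul (Nat.cast_nonneg _), Complex.ofReal_mul, loopValue, loopValue]

theorem sum_semidirect {ι M : Type*} [Fintype ι] [DecidableEq ι] [AddCommMonoid M]
    (y : (ι → G ⋊[φ] Θ) → M) :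
    ∑ b, y b = ∑ c : ι → G, ∑ t : ι → Θ, y fun j => ⟨c j, t j⟩ := by
  rw [← Fintype.sum_prod_type']
  exact Fintype.sum_equiv
    (((Equiv.refl ι).arrowCongr SemidirectProduct.equivProd).trans
      (Equiv.arrowProdEquivProdArrow ι (fun _ => G) fun _ => Θ))
    _ _ fun _ => rfl

theorem F_succ_apply (n : ℕ) (x : Box (G ⋊[φ] Θ) (succ n)) (a : Fin (n + 1) → G ⋊[φ] Θ) :
    F φ (succ n) x a = ((Fintype.card Θ : ℂ) ^ (n + 1))⁻¹ *
      ∑ t : Fin (n + 1) → Θ, x fun j => ⟨(a j).left, t j⟩ := by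
  classical
  calc F φ (succ n) x a
      = ∑ b : Fin (n + 1) → G ⋊[φ] Θ,
          x b * ∏ j, if (a j).left = (b j).left then (Fintype.card Θ : ℂ)⁻¹ else 0 := by
        refine (Z_apply_of_regionEquiv (surroundRegionEquiv n) (fun _ => rfl) _ a).trans ?_
        rw [surround_succ_turning, zpow_zero, one_mul]
        refine Fintype.sum_congr _ _ fun b => (Fintype.prod_option (α := Fin (n + 1)) _).trans ?_
        exact congrArg (x b * ·) (Finset.prod_congr rfl fun j _ => q_apply _)
    _ = ∑ c : Fin (n + 1) → G, ∑ t : Fin (n + 1) → Θ,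
          if (fun j => (a j).left) = c then
            x (fun j => ⟨c j, t j⟩) * ((Fintype.card Θ : ℂ) ^ (n + 1))⁻¹ else 0 := by
        simp only [sum_semidirect, Finset.prod_ite_zero, Finset.mem_univ, forall_const, mul_ite,
          mul_zero, Finset.prod_const, Finset.card_univ, Fintype.card_fin, inv_pow, funext_iff]
        congr
    _ = _ := by
        rw [Finset.sum_comm]
        simp only [Finset.sum_ite_eq, Finset.mem_univ, if_true]
        rw [← Finset.sum_mul, mul_comm]

theorem F_apply_of_size_eq_zero {k : Col} (hk : k.size = 0) (x : Box (G ⋊[φ] Θ) k) :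
    F φ k x = x := by
  funext a
  refine (Z_apply_of_regionEquiv
    ((surroundZeroRegionEquiv hk).trans (Equiv.sumEmpty _ Empty).symm) (fun _ => rfl) _ a).trans ?_
  have : IsEmpty (Fin k.size) := hk ▸ Fin.isEmpty
  rw [surround_zero_turning hk, zpow_zero, one_mul, Fintype.sum_unique]
  refine (Fintype.prod_option (α := Fin k.size) _).trans ?_
  rw [Fintype.prod_empty, mul_one]
  rfl

theorem apply_eq_of_sides_le_one {H : Type*} [Group H] {k : Col} (hk : k.sides ≤ 1) {x : Box H k}
    (hx : x ∈ P H k) (a b : Fin k.sides → H) : x a = x b := by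
  have := Fin.subsingleton_iff_le_one.2 hk
  rcases isEmpty_or_nonempty (Fin k.sides) with _ | ⟨⟨j⟩⟩
  · rw [Subsingleton.elim a b]
  · rw [← hx (b j * (a j)⁻¹) a]
    refine congrArg x (funext fun i => ?_)
    rw [Subsingleton.elim i j, inv_mul_cancel_right]

theorem F_apply {k : Col} {x : Box (G ⋊[φ] Θ) k} (hx : x ∈ P (G ⋊[φ] Θ) k)
    (a : Fin k.sides → G ⋊[φ] Θ) :
    F φ k x a = ((Fintype.card Θ : ℂ) ^ k.sides)⁻¹ *
      ∑ t : Fin k.sides → Θ, x fun j => ⟨(a j).left, t j⟩ := by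
  cases k with
  | succ n => exact F_succ_apply n x a
  | _ =>
    rw [F_apply_of_size_eq_zero rfl]
    simp [apply_eq_of_sides_le_one (by simp [sides]) hx _ a]

theorem F_lift {k : Col} {f : Box G k} (hf : f ∈ PTheta φ k) :
    F φ k (lift φ k f) = lift φ k f := by
  funext a
  simp [F_apply (lift_mem_P hf), lift_apply]

theorem lift_mem_PPrime {k : Col} {f : Box G k} (hf : f ∈ PTheta φ k) :
    lift φ k f ∈ PPrime φ k :=
  ⟨lift φ k f, lift_mem_P hf, F_lift hf⟩

theorem sum_states_left (T : Tangle) (c : Fin T.ext.sides → G) (w : (T.Side → G) → ℂ) :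
    ∑ t : Fin T.ext.sides → Θ, ∑ s ∈ states T (fun j => (⟨c j, t j⟩ : G ⋊[φ] Θ)),
        w (fun x => (s x).left) =
      (Fintype.card Θ : ℂ) ^ T.regions * ∑ s ∈ states T c, w s := by
  classical
  have extend_iff (t : Fin T.ext.sides → Θ) (r : T.Region → G) (u : T.Region → Θ) :
      ((fun j => ⟨r (T.region (Sum.inl j)), u (T.region (Sum.inl j))⟩) =
        fun j => (⟨c j, t j⟩ : G ⋊[φ] Θ)) ↔
      (fun j => u (T.region (Sum.inl j))) = t ∧ (fun j => r (T.region (Sum.inl j))) = c := by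
    simp only [funext_iff, SemidirectProduct.ext_iff, forall_and, and_comm]
  calc _ = ∑ t : Fin T.ext.sides → Θ, ∑ r : T.Region → G, ∑ u : T.Region → Θ,
          if (fun j => u (T.region (Sum.inl j))) = t then
            if (fun j => r (T.region (Sum.inl j))) = c then w (r ∘ T.region) else 0 else 0 := by
        refine Fintype.sum_congr _ _ fun t => (sum_states T _ _).trans ?_
        rw [Finset.sum_filter, sum_semidirect]
        simp only [extend_iff, ite_and]
        rfl
    _ = ∑ r : T.Region → G, ∑ _u : T.Region → Θ,
          if (fun j => r (T.region (Sum.inl j))) = c then w (r ∘ T.region) else 0 := by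
        rw [Finset.sum_comm]
        refine Fintype.sum_congr _ _ fun r => ?_
        rw [Finset.sum_comm]
        simp
    _ = _ := by
        rw [sum_states, Finset.sum_filter, Finset.mul_sum]
        simp [T.regions_eq_card]

theorem sum_Z_lift (T : Tangle) (x : ∀ i, Box G (T.int i)) (c : Fin T.ext.sides → G) :
    ∑ t : Fin T.ext.sides → Θ, Z T (fun i => lift φ _ (x i)) (fun j => ⟨c j, t j⟩) =
      loopValue Θ ^ (T.turning + 2 * T.regions) * Z T x c := by
  simp only [Z_apply, lift_apply, ← loopValue.eq_1]
  rw [← Finset.mul_sum, sum_states_left T c fun s => ∏ i, x i fun j => s (Sum.inr (Sum.inl ⟨i, j⟩)),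
    loopValue_semidirect, mul_zpow, zpow_add₀ (loopValue_ne_zero Θ), ← card_zpow_eq_loopValue_zpow,
    zpow_natCast]
  ring

end Semidirect

section Scalars

variable (Θ : Type*) [Fintype Θ]

/-- The factor by which `Φ_k` differs from `lift`. -/
def phiScalar (k : Col) : ℂ := (Fintype.card Θ : ℂ) ^ (-((k.size / 2 : ℕ) : ℤ))

theorem phiScalar_eq (k : Col) :
    phiScalar Θ k = loopValue Θ ^ (-(2 * ((k.size / 2 : ℕ) : ℤ))) := by
  rw [phiScalar, card_zpow_eq_loopValue_zpow, mul_neg]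

theorem prod_phiScalar (T : Tangle) :
    ∏ i, phiScalar Θ (T.int i) =
      loopValue Θ ^ (-(2 * ∑ i, (((T.int i).size / 2 : ℕ) : ℤ))) := by
  simp only [phiScalar, zpow_neg, zpow_natCast, Finset.prod_inv_distrib, Finset.prod_pow_eq_pow_sum]
  rw [← zpow_natCast, card_zpow_eq_loopValue_zpow, Nat.cast_sum]

theorem phiScalar_ext [Nonempty Θ] (T : Tangle) :
    phiScalar Θ T.ext = alpha Θ T * (∏ i, phiScalar Θ (T.int i)) *
      (((Fintype.card Θ : ℂ) ^ T.ext.sides)⁻¹ * loopValue Θ ^ (T.turning + 2 * T.regions)) := by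
  rw [prod_phiScalar, phiScalar_eq, alpha, ← loopValue.eq_1, ← zpow_natCast, ← zpow_neg,
    card_zpow_eq_loopValue_zpow, ← zpow_add₀ (loopValue_ne_zero Θ),
    ← zpow_add₀ (loopValue_ne_zero Θ), ← zpow_add₀ (loopValue_ne_zero Θ), Tangle.turning_eq,
    Tangle.c, Col.sides_eq, Tangle.halfColours]
  push_cast
  ring_nf

end Scalars

section Phi

variable {G Θ : Type*} [Group G] [Group Θ] {φ : Θ →* MulAut G}

theorem eq_smul_one {k : Col} (f : PTheta φ k) (hk : k.sides ≤ 1) :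
    f = (f : Box G k) (fun _ => 1) • one φ k :=
  Subtype.ext <| funext fun a =>
    (apply_eq_of_sides_le_one hk f.2.1 a fun _ => 1).trans (mul_one _).symm

theorem apply_insertNth_aut_relSpins {m : ℕ} {f : Box G (succ m)} (hf : f ∈ PTheta φ (succ m))
    (θ : Θ) (a : Fin (m + 1) → G) :
    f ((baseSide m).insertNth 1 fun j => φ θ (relSpins m a j)) = f a := by
  have hins : (baseSide m).insertNth 1 (fun j => φ θ (relSpins m a j)) =
      fun j => φ θ ((a (baseSide m))⁻¹ * a j) := by
    rw [Fin.insertNth_eq_iff]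
    exact ⟨by simp, rfl⟩
  calc f _ = f fun j => φ θ ((a (baseSide m))⁻¹ * a j) := congrArg f hins
    _ = f fun j => (a (baseSide m))⁻¹ * a j := hf.2 θ _
    _ = f a := hf.1 _ a

theorem relSpins_semidirect_eq_iff {m : ℕ} (a : Fin (m + 1) → G ⋊[φ] Θ) (g : Fin m → G) (θ : Θ)
    (γ : Fin m → Θ) :
    relSpins m a = (fun j => ⟨φ θ (g j), γ j⟩) ↔
      (fun j => (relSpins m a j).right) = γ ∧
        relSpins m (fun j => (a j).left) = fun j => φ ((a (baseSide m)).right * θ) (g j) := by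
  simp only [funext_iff, ← forall_and]
  refine forall_congr' fun j => ?_
  rw [SemidirectProduct.ext_iff, and_comm]
  refine and_congr_right fun _ => ?_
  rw [relSpins, left_inv_mul, map_inv, MulAut.inv_apply, MulEquiv.symm_apply_eq, map_mul φ,
    MulAut.mul_apply]
  rfl

variable [Fintype G] [Fintype Θ]

open Classical in
theorem thetaS_apply (m : ℕ) (g : Fin m → G) (a : Fin (m + 1) → G) :
    (thetaS φ m g : Box G (succ m)) a = loopValue G ^ (star m).turning *
      ∑ θ : Θ, if relSpins m a = fun j => φ θ (g j) then 1 else 0 := by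
  refine (Finset.sum_apply _ _ _).trans ?_
  rw [Finset.mul_sum]
  exact Finset.sum_congr rfl fun θ _ => S_apply m _ a

open Classical in
theorem U_apply (m : ℕ) (g : Fin m → G) (a : Fin (m + 1) → G ⋊[φ] Θ) :
    U φ m g a = loopValue (G ⋊[φ] Θ) ^ (star m).turning *
      ∑ θ : Θ, if relSpins m (fun j => (a j).left) = fun j => φ θ (g j) then 1 else 0 := by
  calc U φ m g a
      = loopValue (G ⋊[φ] Θ) ^ (star m).turning * ∑ θ : Θ, ∑ γ : Fin m → Θ,
          if relSpins m a = fun j => (⟨φ θ (g j), γ j⟩ : G ⋊[φ] Θ) then 1 else 0 := by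
        simp only [Finset.mul_sum]
        refine (Finset.sum_apply _ _ _).trans (Finset.sum_congr rfl fun θ _ => ?_)
        refine (Finset.sum_apply _ _ _).trans (Finset.sum_congr rfl fun γ _ => ?_)
        exact (S_apply m _ a).trans (by congr)
    _ = loopValue (G ⋊[φ] Θ) ^ (star m).turning * ∑ θ : Θ,
          if relSpins m (fun j => (a j).left) = fun j => φ ((a (baseSide m)).right * θ) (g j)
          then 1 else 0 := by
        simp only [relSpins_semidirect_eq_iff, ite_and, Finset.sum_ite_eq, Finset.mem_univ, if_true]
    _ = _ := congrArg _ (Fintype.sum_equiv (Equiv.mulLeft (a (baseSide m)).right) _ _ fun _ => rfl)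

theorem U_eq (m : ℕ) (g : Fin m → G) :
    U φ m g = loopValue Θ ^ (star m).turning • lift φ (succ m) (thetaS φ m g) := by
  funext a
  rw [Pi.smul_apply, lift_apply, smul_eq_mul]
  refine (U_apply m g a).trans (Eq.trans ?_ (congrArg _ (thetaS_apply m g _).symm))
  rw [loopValue_semidirect, mul_zpow, mul_comm (_ ^ _), mul_assoc]
  rfl

variable (φ) in
/-- The maps `Φ_k`: up to a factor, the pull-back along the projection of the spins to `G`. -/
def phi (k : Col) : PTheta φ k →ₗ[ℂ] PPrime φ k :=
  phiScalar Θ k • (lift φ k).restrict fun _ hf => lift_mem_PPrime hf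

theorem phi_apply (k : Col) (f : PTheta φ k) :
    (phi φ k f : Box (G ⋊[φ] Θ) k) = phiScalar Θ k • lift φ k f := rfl

theorem isPhi_phi : IsPhi φ (phi φ) := by
  refine ⟨fun m g => ?_, ?_, ?_⟩
  · rw [phi_apply, U_eq, smul_smul, mul_assoc, ← loopValue.eq_1,
      ← zpow_add₀ (loopValue_ne_zero Θ), star_turning, sub_add_sub_cancel', sub_self, zpow_zero,
      mul_one]
    rfl
  all_goals
    funext a
    simp [phi_apply, phiScalar, size, lift_apply, one]

theorem sum_smul_thetaS {m : ℕ} (f : PTheta φ (succ m)) :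
    ∑ g : Fin m → G, (f : Box G (succ m)) ((baseSide m).insertNth 1 g) • thetaS φ m g =
      (loopValue G ^ (star m).turning * Fintype.card Θ) • f := by
  classical
  refine Subtype.ext (funext fun a => ?_)
  have aut_iff (θ : Θ) (g : Fin m → G) :
      (relSpins m a = fun j => φ θ (g j)) ↔ (fun j => φ θ⁻¹ (relSpins m a j)) = g := by
    simp only [funext_iff, map_inv, MulAut.inv_apply, MulEquiv.symm_apply_eq]
  calc _ = ∑ g : Fin m → G, (f : Box G (succ m)) ((baseSide m).insertNth 1 g) *
          (thetaS φ m g : Box G (succ m)) a := by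
        rw [Submodule.coe_sum, Finset.sum_apply]
        rfl
    _ = loopValue G ^ (star m).turning * ∑ θ : Θ, ∑ g : Fin m → G,
          if (fun j => φ θ⁻¹ (relSpins m a j)) = g then
            (f : Box G (succ m)) ((baseSide m).insertNth 1 g) else 0 := by
        rw [Finset.sum_comm, Finset.mul_sum]
        refine Finset.sum_congr rfl fun g _ => ?_
        refine (congrArg _ (thetaS_apply m g a)).trans ?_
        rw [mul_left_comm, Finset.mul_sum]
        simp only [aut_iff, mul_ite, mul_one, mul_zero]
    _ = loopValue G ^ (star m).turning * ∑ _θ : Θ, (f : Box G (succ m)) a := by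
        simp only [Finset.sum_ite_eq, Finset.mem_univ, if_true,
          apply_insertNth_aut_relSpins f.2 _ a]
    _ = _ := by
        rw [Finset.sum_const, Finset.card_univ, nsmul_eq_mul, ← mul_assoc]
        rfl

theorem span_range_thetaS (m : ℕ) : Submodule.span ℂ (Set.range (thetaS φ m)) = ⊤ := by
  refine eq_top_iff.2 fun f _ => ?_
  have hne : loopValue G ^ (star m).turning * Fintype.card Θ ≠ 0 :=
    mul_ne_zero (zpow_ne_zero _ (loopValue_ne_zero G)) (Nat.cast_ne_zero.2 Fintype.card_ne_zero)
  rw [← Submodule.smul_mem_iff _ hne, ← sum_smul_thetaS]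
  exact Submodule.sum_mem _ fun g _ => Submodule.smul_mem _ _ (Submodule.subset_span ⟨g, rfl⟩)

theorem eq_of_isPhi {Φ Ψ : ∀ k, PTheta φ k →ₗ[ℂ] PPrime φ k} (hΦ : IsPhi φ Φ) (hΨ : IsPhi φ Ψ) :
    Φ = Ψ := by
  obtain ⟨hΦ, hΦplus, hΦminus⟩ := hΦ
  obtain ⟨hΨ, hΨplus, hΨminus⟩ := hΨ
  funext k
  cases k with
  | zeroPlus =>
    ext1 f
    rw [eq_smul_one f zero_le_one, map_smul, map_smul, Subtype.ext (hΦplus.trans hΨplus.symm)]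
  | zeroMinus =>
    ext1 f
    rw [eq_smul_one f le_rfl, map_smul, map_smul, Subtype.ext (hΦminus.trans hΨminus.symm)]
  | succ m =>
    refine LinearMap.ext_on (span_range_thetaS m) ?_
    rintro _ ⟨g, rfl⟩
    exact Subtype.ext ((hΦ m g).trans (hΨ m g).symm)

theorem Z_phi (T : Tangle) (x : ∀ i, PTheta φ (T.int i)) :
    Z T (fun i => (phi φ (T.int i) (x i) : Box (G ⋊[φ] Θ) (T.int i))) =
      (∏ i, phiScalar Θ (T.int i)) • Z T fun i => lift φ (T.int i) (x i) :=
  (Z T).map_smul_univ _ _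

theorem mem_intertwined_phi (T : Tangle) : T ∈ intertwined φ (phi φ) := by
  intro x
  refine Subtype.ext (funext fun a => ?_)
  change phiScalar Θ T.ext * Z T (fun i => (x i : Box G (T.int i))) (fun j => (a j).left) =
    (alpha Θ T • F φ T.ext
      (Z T fun i => (phi φ (T.int i) (x i) : Box (G ⋊[φ] Θ) (T.int i)))) a
  rw [Z_phi, map_smul, smul_smul, Pi.smul_apply, smul_eq_mul,
    F_apply (Z_mem T _ fun i => lift_mem_P (x i).2), sum_Z_lift, phiScalar_ext]
  ring

end Phi

end

end GroupPlanar

theorem theorem4p9_general {G Θ : Type*} [Group G] [Fintype G] [Group Θ] [Fintype Θ]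
    (φ : Θ →* MulAut G) :
    (∃! Φ : ∀ k, GroupPlanar.PTheta φ k →ₗ[ℂ] GroupPlanar.PPrime φ k, GroupPlanar.IsPhi φ Φ) ∧
    ∀ Φ : ∀ k, GroupPlanar.PTheta φ k →ₗ[ℂ] GroupPlanar.PPrime φ k, GroupPlanar.IsPhi φ Φ →
      GroupPlanar.intertwined φ Φ = Set.univ := by
  refine ⟨⟨GroupPlanar.phi φ, GroupPlanar.isPhi_phi, fun Φ hΦ =>
    GroupPlanar.eq_of_isPhi hΦ GroupPlanar.isPhi_phi⟩, fun Φ hΦ => ?_⟩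
  rw [GroupPlanar.eq_of_isPhi hΦ GroupPlanar.isPhi_phi]
  exact Set.eq_univ_of_forall GroupPlanar.mem_intertwined_phi

theorem theorem4p9 {G Θ : Type*} [Group G] [Fintype G] [Group Θ] [Fintype Θ]
    (φ : Θ →* MulAut G) :
    (∃! Φ : ∀ k, GroupPlanar.PTheta φ k →ₗ[ℂ] GroupPlanar.PPrime φ k, GroupPlanar.IsPhi φ Φ) ∧
    ∀ Φ : ∀ k, GroupPlanar.PTheta φ k →ₗ[ℂ] GroupPlanar.PPrime φ k, GroupPlanar.IsPhi φ Φ →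
      GroupPlanar.generatingTangles ⊆ GroupPlanar.intertwined φ Φ :=
  ⟨(theorem4p9_general φ).1, fun Φ hΦ =>
    ((theorem4p9_general φ).2 Φ hΦ).symm ▸ Set.subset_univ _⟩
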